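/- Theorem (number of regions of a $\beta$-extended Shi arrangement). Let $n\ge 1$, let $\beta=(\beta(1),\dots,\beta(n))\in\mathbb{N}^n$ (where $0\in\mathbb{N}$), and let $V_{n-1}=\{x\in\mathbb{R}^n : x_1+\cdots+x_n=0\}$. Let $\mathcal{A}$ be the $\beta$-extended Shi arrangement, that is, the collection of all hyperplanes $$x_i-x_j=-\beta(i),\,-\beta(i)+1,\,\dots,\,\beta(j)+1\qquad(1\le i<j\le n)$$ in $V_{n-1}$. Then the number $r(\mathcal{A})$ of regions of $\mathcal{A}$ (the connected components of the complement in $V_{n-1}$ of the union of these hyperplanes) is finite and equal to $$r(\mathcal{A})=\Bigl(\sum_{j=1}^n(\beta(j)+1)+1\Bigr)^{n-1}.$$ -/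

import Mathlib

/-- The space `V_{n-1}`: the vectors of `ℝ^n` whose coordinates sum to zero. -/
def sumZeroSpace (n : ℕ) : Submodule ℝ (Fin n → ℝ) where
  carrier := {x | ∑ i, x i = 0}
  add_mem' := by
    intro a b ha hb
    simp only [Set.mem_ofPred_eq, Pi.add_apply, Finset.sum_add_distrib] at *
    rw [ha, hb, add_zero]
  zero_mem' := by simp
  smul_mem' := by
    intro c x hx
    simp only [Set.mem_ofPred_eq, Pi.smul_apply, smul_eq_mul, ← Finset.mul_sum] at *
    rw [hx, mul_zero]

/-- The hyperplane `x_i - x_j = c` in `V_{n-1}` (used for `i ≠ j` only). -/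
def diffHyperplane {n : ℕ} (i j : Fin n) (c : ℝ) : Set (sumZeroSpace n) :=
  {x | (x : Fin n → ℝ) i - (x : Fin n → ℝ) j = c}

/-- The `β`-extended Shi arrangement in `V_{n-1}`: all the hyperplanes
`x_i - x_j = m` with `i < j` and `m = -β(i), -β(i) + 1, …, β(j) + 1`. -/
def extendedShiArrangement {n : ℕ} (β : Fin n → ℕ) : Set (Set (sumZeroSpace n)) :=
  {H | ∃ i j : Fin n, i < j ∧
    ∃ m : ℤ, -(β i : ℤ) ≤ m ∧ m ≤ (β j : ℤ) + 1 ∧ H = diffHyperplane i j (m : ℝ)}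

/-- The regions of an arrangement, given as a set of hyperplanes in a real topological vector
space: the connected components of the complement of the union of the hyperplanes. -/
def arrangementRegions {V : Type*} [TopologicalSpace V] (A : Set (Set V)) : Set (Set V) :=
  {R | ∃ x ∈ (⋃₀ A)ᶜ, R = connectedComponentIn (⋃₀ A)ᶜ x}

/-! The proof is a finite field method. Off the hyperplanes, two points lie in the same region
exactly when they lie on the same side of every hyperplane, so regions are counted by realized sign
patterns (`arrangementRegions_count`). Adding a hyperplane increases the number of patterns by the
count for the restriction to it, and decreases the number of avoiding points modulo `q` by the
corresponding count. Induction on the number of hyperplanes (`exists_charPoly`) gives one polynomial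
`P` that counts points modulo every large `q` and whose value at `-1` is, up to the sign `(-1) ^ n`,
the number of patterns.

For the Shi arrangement put `b i = β i + 1` and `s = ∑ b i`. A point modulo `q` off the hyperplanes
is a placement of disjoint arcs of lengths `b i` on a circle of `q` cells, where an arc directly
followed by another has the smaller label. Count pairs of a placement and an empty cell: each
placement has `q - s` empty cells, and by rotation each cell is empty in as many placements as cell
`0`. Cutting the circle there leaves a line, where a placement is determined by the number of empty
cells before each arc, freely chosen among `q - s` values; this gives `(q - s) ^ n`. Hence `P = X (X
- s) ^ (n - 1)`, and setting `X = -1` gives the theorem. -/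

open Filter Topology Polynomial

/-! ### Sign patterns of real points, and their deletion-restriction rule. -/

/-- The point `x` lies on none of the hyperplanes `x_i - x_j = m` listed in `L`. -/
def Avoids {ι R : Type*} [Ring R] (L : List (ι × ι × ℤ)) (x : ι → R) : Prop :=
  ∀ t ∈ L, x t.1 - x t.2.1 ≠ (t.2.2 : R)

theorem avoids_cons {ι R : Type*} [Ring R] {L : List (ι × ι × ℤ)} {t : ι × ι × ℤ} {x : ι → R} :
    Avoids (t :: L) x ↔ x t.1 - x t.2.1 ≠ (t.2.2 : R) ∧ Avoids L x := by
  simp [Avoids]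

open Classical in
/-- The list telling, for each hyperplane of `L`, whether `x` is on its positive side. -/
noncomputable def signPattern {ι : Type*} (L : List (ι × ι × ℤ)) (x : ι → ℝ) : List Bool :=
  L.map fun t => decide ((t.2.2 : ℝ) < x t.1 - x t.2.1)

/-- The sign patterns of points off the hyperplanes of `L`. -/
def realizedPatterns {ι : Type*} (L : List (ι × ι × ℤ)) : Set (List Bool) :=
  signPattern L '' {x | Avoids L x}

theorem realizedPatterns_finite {ι : Type*} (L : List (ι × ι × ℤ)) :
    (realizedPatterns L).Finite := by
  refine (List.finite_length_eq Bool L.length).subset ?_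
  rintro _ ⟨x, -, rfl⟩
  simp [signPattern]

theorem signPattern_eq_iff {ι : Type*} {L : List (ι × ι × ℤ)} {x y : ι → ℝ} :
    signPattern L x = signPattern L y ↔
      ∀ t ∈ L, ((t.2.2 : ℝ) < x t.1 - x t.2.1 ↔ (t.2.2 : ℝ) < y t.1 - y t.2.1) := by
  simp [signPattern, List.map_inj_left]

theorem eventually_signPattern_eq {ι : Type*} {L : List (ι × ι × ℤ)} {x : ι → ℝ}
    (hx : Avoids L x) (v : ι → ℝ) :
    ∀ᶠ ε : ℝ in 𝓝 0, Avoids L (x + ε • v) ∧ signPattern L (x + ε • v) = signPattern L x := by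
  have key : ∀ t ∈ L, ∀ᶠ ε : ℝ in 𝓝 0,
      (x + ε • v) t.1 - (x + ε • v) t.2.1 ≠ (t.2.2 : ℝ) ∧
      ((t.2.2 : ℝ) < (x + ε • v) t.1 - (x + ε • v) t.2.1 ↔ (t.2.2 : ℝ) < x t.1 - x t.2.1) := by
    intro t ht
    have hc : Continuous fun ε : ℝ => (x + ε • v) t.1 - (x + ε • v) t.2.1 := by
      simp only [Pi.add_apply, Pi.smul_apply, smul_eq_mul]; fun_prop
    have h0 := hc.tendsto 0
    simp only [zero_smul, add_zero] at h0
    rcases lt_or_gt_of_ne (hx t ht) with h | h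
    · filter_upwards [h0.eventually_lt_const h] with ε hε
      exact ⟨hε.ne, iff_of_false hε.not_gt h.not_gt⟩
    · filter_upwards [h0.eventually_const_lt h] with ε hε
      exact ⟨hε.ne', iff_of_true hε h⟩
  filter_upwards [(eventually_all_finite L.finite_toSet).2 key] with ε hε
  exact ⟨fun t ht => (hε t ht).1, signPattern_eq_iff.2 fun t ht => (hε t ht).2⟩

/-- Points off the hyperplanes with the same pattern form a convex set. -/
theorem avoids_combo {ι : Type*} {L : List (ι × ι × ℤ)} {x y : ι → ℝ}
    (hx : Avoids L x) (hy : Avoids L y) (h : signPattern L x = signPattern L y)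
    {a b : ℝ} (ha : 0 ≤ a) (hb : 0 ≤ b) (hab : a + b = 1) :
    Avoids L (a • x + b • y) ∧ signPattern L (a • x + b • y) = signPattern L y := by
  rw [signPattern_eq_iff] at h
  have key : ∀ t ∈ L, (a • x + b • y) t.1 - (a • x + b • y) t.2.1 ≠ (t.2.2 : ℝ) ∧
      ((t.2.2 : ℝ) < (a • x + b • y) t.1 - (a • x + b • y) t.2.1 ↔
        (t.2.2 : ℝ) < y t.1 - y t.2.1) := by
    intro t ht
    have e : (a • x + b • y) t.1 - (a • x + b • y) t.2.1 =
        a • (x t.1 - x t.2.1) + b • (y t.1 - y t.2.1) := by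
      simp; ring
    rw [e]
    rcases lt_or_gt_of_ne (hy t ht) with h1 | h1
    · have h2 : x t.1 - x t.2.1 < t.2.2 :=
        lt_of_le_of_ne (not_lt.1 fun h3 => h1.not_gt ((h t ht).1 h3)) (hx t ht)
      have h3 := (convex_Iio ((t.2.2 : ℤ) : ℝ)) h2 h1 ha hb hab
      exact ⟨ne_of_lt h3, iff_of_false (not_lt.2 (le_of_lt h3)) h1.not_gt⟩
    · have h2 := (h t ht).2 h1
      have h3 := (convex_Ioi ((t.2.2 : ℤ) : ℝ)) h2 h1 ha hb hab
      exact ⟨ne_of_gt h3, iff_of_true h3 h1⟩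
  exact ⟨fun t ht => (key t ht).1, signPattern_eq_iff.2 fun t ht => (key t ht).2⟩

/-- Deletion and restriction for the sign patterns. -/
theorem ncard_realizedPatterns_cons {ι : Type*} [DecidableEq ι] (L : List (ι × ι × ℤ))
    {i j : ι} (hij : i ≠ j) (m : ℤ) :
    (realizedPatterns ((i, j, m) :: L)).ncard = (realizedPatterns L).ncard +
      (signPattern L '' {x | Avoids L x ∧ x i - x j = m}).ncard := by
  set A := signPattern L '' {x | Avoids L x ∧ (m : ℝ) < x i - x j} with hA
  set B := signPattern L '' {x | Avoids L x ∧ x i - x j < (m : ℝ)} with hB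
  have hfin := realizedPatterns_finite L
  have hAf : A.Finite := hfin.subset (Set.image_mono fun x hx => hx.1)
  have hBf : B.Finite := hfin.subset (Set.image_mono fun x hx => hx.1)
  have hperturb : ∀ x : ι → ℝ, Avoids L x → x i - x j = m →
      signPattern L x ∈ A ∧ signPattern L x ∈ B := by
    intro x hx hm
    -- A small move of coordinate `i` alone leaves the hyperplane on either side without crossing
    -- those of `L`.
    obtain ⟨δ, hδ, hball⟩ := Metric.eventually_nhds_iff.1
      (eventually_signPattern_eq hx (Pi.single i 1))
    have e : ∀ ε : ℝ, (x + ε • (Pi.single i 1 : ι → ℝ)) i -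
        (x + ε • (Pi.single i 1 : ι → ℝ)) j = m + ε := by
      intro ε; simp [hij.symm]; linarith
    constructor
    · have h := hball (y := δ / 2) (by simp [abs_of_pos hδ]; linarith)
      exact ⟨_, ⟨h.1, by rw [e]; linarith⟩, h.2⟩
    · have h := hball (y := -(δ / 2)) (by simp [abs_of_pos hδ]; linarith)
      exact ⟨_, ⟨h.1, by rw [e]; linarith⟩, h.2⟩
  have hunion : A ∪ B = realizedPatterns L := by
    apply Set.Subset.antisymm
    · exact Set.union_subset (Set.image_mono fun x hx => hx.1) (Set.image_mono fun x hx => hx.1)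
    · rintro _ ⟨x, hx, rfl⟩
      rcases lt_trichotomy (x i - x j) m with h | h | h
      · exact Or.inr ⟨x, ⟨hx, h⟩, rfl⟩
      · exact Or.inl (hperturb x hx h).1
      · exact Or.inl ⟨x, ⟨hx, h⟩, rfl⟩
  have hinter : A ∩ B = signPattern L '' {x | Avoids L x ∧ x i - x j = m} := by
    apply Set.Subset.antisymm
    · rintro _ ⟨⟨x, ⟨hx, hxm⟩, rfl⟩, ⟨y, ⟨hy, hym⟩, hxy⟩⟩
      -- The weights `u / (u + w)` on `y` and `w / (u + w)` on `x` give the point where the segment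
      -- crosses the hyperplane. Hence the patterns seen on both sides are those seen on the
      -- hyperplane itself.
      set u := x i - x j - m with hu
      set w := m - (y i - y j) with hw
      have hu0 : 0 < u := by linarith
      have hw0 : 0 < w := by linarith
      obtain ⟨h1, h2⟩ := avoids_combo hy hx hxy (a := u / (u + w)) (b := w / (u + w))
        (by positivity) (by positivity) (by field_simp)
      refine ⟨_, ⟨h1, ?_⟩, h2⟩
      simp only [Pi.add_apply, Pi.smul_apply, smul_eq_mul]
      field_simp
      rw [hu, hw]; ring
    · rintro _ ⟨x, ⟨hx, hm⟩, rfl⟩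
      exact hperturb x hx hm
  have hcons : realizedPatterns ((i, j, m) :: L) = List.cons true '' A ∪ List.cons false '' B := by
    ext p
    constructor
    · rintro ⟨x, hx, rfl⟩
      obtain ⟨h1, h2⟩ := avoids_cons.1 hx
      rcases lt_or_gt_of_ne h1 with h | h
      · exact Or.inr ⟨_, ⟨x, ⟨h2, h⟩, rfl⟩, by simpa [signPattern] using le_of_lt h⟩
      · exact Or.inl ⟨_, ⟨x, ⟨h2, h⟩, rfl⟩, by simpa [signPattern] using h⟩
    · rintro (⟨_, ⟨x, ⟨h2, h⟩, rfl⟩, rfl⟩ | ⟨_, ⟨x, ⟨h2, h⟩, rfl⟩, rfl⟩)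
      · exact ⟨x, avoids_cons.2 ⟨ne_of_gt h, h2⟩, by simp [signPattern, h]⟩
      · exact ⟨x, avoids_cons.2 ⟨ne_of_lt h, h2⟩, by simp [signPattern, h.le]⟩
  rw [hcons, Set.ncard_union_eq _ (hAf.image _) (hBf.image _),
    Set.ncard_image_of_injective _ List.cons_injective,
    Set.ncard_image_of_injective _ List.cons_injective, ← hunion, ← hinter,
    Set.ncard_union_add_ncard_inter _ _ hAf hBf]
  rw [Set.disjoint_left]
  rintro _ ⟨p, -, rfl⟩ ⟨p', -, h⟩
  simp at h

/-! ### Restriction to a hyperplane by eliminating a coordinate. -/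

/-- Solving `x_i = x_j + m` for `x_i`: each coordinate is a remaining one plus a constant. -/
def solveCoord {ι : Type*} [DecidableEq ι] (i j : ι) (hij : j ≠ i) (m : ℤ) (a : ι) :
    {a : ι // a ≠ i} × ℤ :=
  if h : a = i then (⟨j, hij⟩, m) else (⟨a, h⟩, 0)

/-- The point of the hyperplane `x_i - x_j = m` with the given remaining coordinates. -/
def extendPoint {ι : Type*} [DecidableEq ι] {R : Type*} [Ring R] (i j : ι) (hij : j ≠ i) (m : ℤ)
    (y : {a : ι // a ≠ i} → R) (a : ι) : R :=
  y (solveCoord i j hij m a).1 + ((solveCoord i j hij m a).2 : R)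

/-- The restriction of a hyperplane to the hyperplane `x_i - x_j = m`. -/
def restrictTriple {ι : Type*} [DecidableEq ι] (i j : ι) (hij : j ≠ i) (m : ℤ)
    (t : ι × ι × ℤ) : {a : ι // a ≠ i} × {a : ι // a ≠ i} × ℤ :=
  ((solveCoord i j hij m t.1).1, (solveCoord i j hij m t.2.1).1,
    t.2.2 - (solveCoord i j hij m t.1).2 + (solveCoord i j hij m t.2.1).2)

section Restrict

variable {ι : Type*} [DecidableEq ι] {R : Type*} [Ring R] {i j : ι} (hij : j ≠ i) (m : ℤ)

theorem extendPoint_sub (y : {a : ι // a ≠ i} → R) :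
    extendPoint i j hij m y i - extendPoint i j hij m y j = m := by
  simp [extendPoint, solveCoord, hij]

theorem extendPoint_injective :
    Function.Injective (extendPoint (R := R) i j hij m) := by
  intro y z h
  funext a
  have := congrFun h a
  simpa [extendPoint, solveCoord, a.2] using this

theorem extendPoint_restrict {x : ι → R} (hx : x i - x j = m) :
    extendPoint i j hij m (fun a => x a) = x := by
  funext a
  by_cases h : a = i
  · subst h
    simp [extendPoint, solveCoord, ← hx]
  · simp [extendPoint, solveCoord, h]

theorem avoids_extendPoint {L : List (ι × ι × ℤ)} {y : {a : ι // a ≠ i} → R} :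
    Avoids L (extendPoint i j hij m y) ↔ Avoids (L.map (restrictTriple i j hij m)) y := by
  simp only [Avoids, List.forall_mem_map]
  refine forall₂_congr fun t _ => not_congr ?_
  simp only [extendPoint, restrictTriple]
  push_cast
  constructor <;> intro h
  · rw [← h]; abel
  · rw [← sub_eq_iff_eq_add, eq_sub_iff_add_eq] at h
    rw [← h]; abel

/-- The ring is arbitrary because this parametrization is used both over `ℝ` and over `ZMod q`. -/
theorem image_extendPoint (L : List (ι × ι × ℤ)) :
    extendPoint (R := R) i j hij m '' {y | Avoids (L.map (restrictTriple i j hij m)) y} =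
      {x : ι → R | Avoids L x ∧ x i - x j = m} := by
  ext x
  constructor
  · rintro ⟨y, hy, rfl⟩
    exact ⟨(avoids_extendPoint hij m).2 hy, extendPoint_sub hij m y⟩
  · rintro ⟨hx, hm⟩
    rw [← extendPoint_restrict hij m hm] at hx
    exact ⟨_, (avoids_extendPoint hij m).1 hx, extendPoint_restrict hij m hm⟩

theorem signPattern_extendPoint (L : List (ι × ι × ℤ)) (y : {a : ι // a ≠ i} → ℝ) :
    signPattern L (extendPoint i j hij m y) =
      signPattern (L.map (restrictTriple i j hij m)) y := by
  simp only [signPattern, List.map_map]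
  refine List.map_congr_left fun t _ => ?_
  simp only [Function.comp, extendPoint, restrictTriple]
  push_cast
  refine decide_eq_decide.2 ?_
  constructor <;> intro h <;> linarith

theorem image_signPattern_hyperplane (L : List (ι × ι × ℤ)) :
    signPattern L '' {x | Avoids L x ∧ x i - x j = m} =
      realizedPatterns (L.map (restrictTriple i j hij m)) := by
  rw [← image_extendPoint hij m L, Set.image_image]
  simp only [signPattern_extendPoint, realizedPatterns]

end Restrict

/-! ### Point counts modulo `q` and the characteristic polynomial. -/

/-- The number of points of `(ℤ/q)^ι` off the hyperplanes of `L`. -/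
noncomputable def modCount {ι : Type*} (L : List (ι × ι × ℤ)) (q : ℕ) : ℕ :=
  {x : ι → ZMod q | Avoids L x}.ncard

/-- Points off `L` are split according to whether they lie on the new hyperplane. Here the
restriction is subtracted, whereas for sign patterns it is added; evaluation at `-1` absorbs the
difference. -/
theorem modCount_cons {ι : Type*} [Fintype ι] [DecidableEq ι] (L : List (ι × ι × ℤ))
    {i j : ι} (hij : j ≠ i) (m : ℤ) (q : ℕ) [NeZero q] :
    modCount ((i, j, m) :: L) q + modCount (L.map (restrictTriple i j hij m)) q =
      modCount L q := by
  rw [modCount, modCount, modCount,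
    ← Set.ncard_image_of_injective _ (extendPoint_injective hij m), image_extendPoint,
    ← Set.ncard_union_eq _ (Set.toFinite _) (Set.toFinite _)]
  · congr 1
    ext x
    simp only [Set.mem_union, Set.mem_ofPred_eq, avoids_cons]
    tauto
  · rw [Set.disjoint_left]
    intro x hx hx'
    exact (avoids_cons.1 hx).1 hx'.2

/-- The number of points modulo large `q` off the hyperplanes is a polynomial in `q`, whose value
at `-1` is, up to sign, the number of realized sign patterns. -/
theorem exists_charPoly (k : ℕ) : ∀ (ι : Type) [Fintype ι] [DecidableEq ι]
    (L : List (ι × ι × ℤ)), L.length = k → ∃ P : ℤ[X],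
      (∀ᶠ q : ℕ in atTop, (modCount L q : ℤ) = P.eval (q : ℤ)) ∧
      ((realizedPatterns L).ncard : ℤ) = (-1) ^ Fintype.card ι * P.eval (-1) := by
  induction k with
  | zero =>
    intro ι _ _ L hL
    obtain rfl := List.length_eq_zero_iff.1 hL
    refine ⟨X ^ Fintype.card ι, ?_, ?_⟩
    · filter_upwards [eventually_gt_atTop 0] with q hq
      have : NeZero q := ⟨hq.ne'⟩
      simp [modCount, Avoids, Set.ncard_univ, Nat.card_eq_fintype_card]
    · have : realizedPatterns ([] : List (ι × ι × ℤ)) = {[]} := by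
        ext p
        constructor
        · rintro ⟨x, -, rfl⟩
          simp [signPattern]
        · rintro rfl
          exact ⟨0, by simp [Avoids], by simp [signPattern]⟩
      simp [this, ← mul_pow]
  | succ k ih =>
    intro ι _ _ L hL
    obtain ⟨⟨i, j, m⟩, L, rfl⟩ := List.exists_cons_of_length_eq_add_one hL
    simp only [List.length_cons, add_left_inj] at hL
    obtain ⟨P, hP, hr⟩ := ih ι L hL
    by_cases hij : j = i
    -- Restriction can produce triples with equal indices: the "hyperplane" `0 = m` is everything if
    -- `m = 0`, and otherwise is empty, modulo `q` as well once `q > |m|`.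
    · subst hij
      by_cases hm : m = 0
      · subst hm
        refine ⟨0, ?_, ?_⟩
        · refine Eventually.of_forall fun q => ?_
          simp [modCount, Avoids]
        · simp [realizedPatterns, Avoids]
      · refine ⟨P, ?_, ?_⟩
        · filter_upwards [hP, eventually_gt_atTop m.natAbs] with q hq hqm
          rw [← hq, modCount, modCount]
          congr 3
          ext x
          rw [avoids_cons]
          refine and_iff_right ?_
          simp only [sub_self]
          intro h
          have h2 := (ZMod.intCast_zmod_eq_zero_iff_dvd m q).1 h.symm
          exact hm (Int.eq_zero_of_abs_lt_dvd h2 (by rw [Int.abs_eq_natAbs]; omega))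
        · rw [← hr]
          congr 1
          have e : ∀ x : ι → ℝ, signPattern ((j, j, m) :: L) x =
              decide ((m : ℝ) < 0) :: signPattern L x := by
            intro x; simp [signPattern]
          have : realizedPatterns ((j, j, m) :: L) =
              List.cons (decide ((m : ℝ) < 0)) '' realizedPatterns L := by
            rw [realizedPatterns, realizedPatterns, Set.image_image]
            simp only [e]
            congr 1
            ext x
            rw [Set.mem_ofPred_eq, Set.mem_ofPred_eq, avoids_cons]
            refine and_iff_right ?_
            simpa using fun h : (0 : ℝ) = m => hm (by exact_mod_cast h.symm)
          rw [this, Set.ncard_image_of_injective _ List.cons_injective]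
    · obtain ⟨Q, hQ, hs⟩ := ih {a : ι // a ≠ i} (L.map (restrictTriple i j hij m)) (by simpa)
      refine ⟨P - Q, ?_, ?_⟩
      · filter_upwards [hP, hQ, eventually_gt_atTop 0] with q h1 h2 h3
        have : NeZero q := ⟨h3.ne'⟩
        rw [eval_sub, ← h1, ← h2, ← modCount_cons L hij m q]
        push_cast; ring
      · rw [ncard_realizedPatterns_cons L (Ne.symm hij), image_signPattern_hyperplane hij m]
        push_cast
        -- The restriction has one coordinate fewer, so its sign is opposite and turns `P - Q` into
        -- a sum of counts.
        have hc : Fintype.card ι = Fintype.card {a : ι // a ≠ i} + 1 := by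
          have := Fintype.card_pos_iff.2 ⟨i⟩
          simp [Fintype.card_subtype_compl]; omega
        rw [hr, hs, eval_sub, hc, pow_succ]
        ring

/-! ### Regions correspond to sign patterns. -/

theorem continuous_coord_sub {n : ℕ} (i j : Fin n) :
    Continuous fun x : sumZeroSpace n => (x : Fin n → ℝ) i - (x : Fin n → ℝ) j :=
  ((continuous_apply i).comp continuous_subtype_val).sub
    ((continuous_apply j).comp continuous_subtype_val)

/-- Off the hyperplanes, two points lie in the same component iff they have the same pattern. -/
theorem connectedComponentIn_eq_iff {n : ℕ} {L : List (Fin n × Fin n × ℤ)} {x y : sumZeroSpace n}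
    (hx : Avoids L (x : Fin n → ℝ)) (hy : Avoids L (y : Fin n → ℝ)) :
    connectedComponentIn {z : sumZeroSpace n | Avoids L (z : Fin n → ℝ)} x =
      connectedComponentIn {z : sumZeroSpace n | Avoids L (z : Fin n → ℝ)} y ↔
      signPattern L (x : Fin n → ℝ) = signPattern L (y : Fin n → ℝ) := by
  set U := {z : sumZeroSpace n | Avoids L (z : Fin n → ℝ)} with hU
  constructor
  · intro h
    have hyU : y ∈ connectedComponentIn U x := h ▸ mem_connectedComponentIn hy
    have hxU : x ∈ connectedComponentIn U x := mem_connectedComponentIn hx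
    have hpre : IsPreconnected (connectedComponentIn U x) := isPreconnected_connectedComponentIn
    have hne : ∀ t ∈ L, ((t.2.2 : ℤ) : ℝ) ∉
        (fun z : sumZeroSpace n => (z : Fin n → ℝ) t.1 - (z : Fin n → ℝ) t.2.1) ''
          connectedComponentIn U x := by
      rintro t ht ⟨z, hz, he⟩
      exact connectedComponentIn_subset U x hz t ht he
    rw [signPattern_eq_iff]
    intro t ht
    have hc := (continuous_coord_sub t.1 t.2.1).continuousOn (s := connectedComponentIn U x)
    constructor
    · intro h1
      by_contra! h2
      exact hne t ht (hpre.intermediate_value hyU hxU hc ⟨h2, h1.le⟩)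
    · intro h1
      by_contra! h2
      exact hne t ht (hpre.intermediate_value hxU hyU hc ⟨h2, h1.le⟩)
  · intro h
    refine connectedComponentIn_eq ?_
    have hconv : Convex ℝ {z : sumZeroSpace n | Avoids L (z : Fin n → ℝ) ∧
        signPattern L (z : Fin n → ℝ) = signPattern L (y : Fin n → ℝ)} := by
      intro u hu v hv a b ha hb hab
      have := avoids_combo hu.1 hv.1 (hu.2.trans hv.2.symm) ha hb hab
      exact ⟨this.1, this.2.trans hv.2⟩
    exact hconv.isPreconnected.subset_connectedComponentIn ⟨hx, h⟩ (fun z hz => hz.1) ⟨hy, rfl⟩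

theorem image_signPattern_sumZeroSpace {n : ℕ} (L : List (Fin n × Fin n × ℤ)) :
    (fun x : sumZeroSpace n => signPattern L (x : Fin n → ℝ)) ''
      {x : sumZeroSpace n | Avoids L (x : Fin n → ℝ)} = realizedPatterns L := by
  apply Set.Subset.antisymm
  · rintro _ ⟨x, hx, rfl⟩
    exact ⟨x, hx, rfl⟩
  · rintro _ ⟨x, hx, rfl⟩
    -- Subtracting the mean brings a point into the sum-zero space without changing coordinate
    -- differences.
    have hmem : (fun i => x i - (∑ k, x k) / n) ∈ sumZeroSpace n := by
      change ∑ i, (x i - (∑ k, x k) / n) = 0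
      rcases Nat.eq_zero_or_pos n with rfl | hn
      · simp
      · rw [Finset.sum_sub_distrib]
        simp only [Finset.sum_const, Finset.card_univ, Fintype.card_fin, nsmul_eq_mul]
        field_simp
        ring
    refine ⟨⟨_, hmem⟩, ?_, ?_⟩
    · intro t ht
      simpa using hx t ht
    · simp [signPattern]

/-- Regions of an arrangement of hyperplanes `x_i - x_j = m` correspond to sign patterns. -/
theorem arrangementRegions_count {n : ℕ} {A : Set (Set (sumZeroSpace n))}
    {L : List (Fin n × Fin n × ℤ)} (hA : (⋃₀ A)ᶜ = {x : sumZeroSpace n | Avoids L (x : Fin n → ℝ)}) :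
    (arrangementRegions A).Finite ∧ (arrangementRegions A).ncard = (realizedPatterns L).ncard := by
  have hex : ∀ p ∈ realizedPatterns L, ∃ x : sumZeroSpace n, Avoids L (x : Fin n → ℝ) ∧
      signPattern L (x : Fin n → ℝ) = p := by
    intro p hp
    rw [← image_signPattern_sumZeroSpace] at hp
    exact hp
  choose! g hg hgp using hex
  have himg : arrangementRegions A =
      (fun p => connectedComponentIn {x : sumZeroSpace n | Avoids L (x : Fin n → ℝ)} (g p)) ''
        realizedPatterns L := by
    rw [arrangementRegions, hA]
    ext R
    constructor
    · rintro ⟨x, hx, rfl⟩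
      have hp : signPattern L (x : Fin n → ℝ) ∈ realizedPatterns L := ⟨x, hx, rfl⟩
      exact ⟨_, hp, (connectedComponentIn_eq_iff (hg _ hp) hx).2 (hgp _ hp)⟩
    · rintro ⟨p, hp, rfl⟩
      exact ⟨g p, hg p hp, rfl⟩
  rw [himg]
  refine ⟨(realizedPatterns_finite L).image _, Set.InjOn.ncard_image ?_⟩
  intro p hp p' hp' h
  rw [← hgp p hp, ← hgp p' hp']
  exact (connectedComponentIn_eq_iff (hg p hp) (hg p' hp')).1 h

/-! ### The Shi arrangement as a list of triples. -/

theorem exists_list_shi {n : ℕ} (β : Fin n → ℕ) : ∃ L : List (Fin n × Fin n × ℤ),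
    ∀ i j m, (i, j, m) ∈ L ↔ i < j ∧ -(β i : ℤ) ≤ m ∧ m ≤ β j + 1 := by
  classical
  refine ⟨(Finset.univ.biUnion fun i => Finset.univ.biUnion fun j =>
    ((Finset.Icc (-(β i : ℤ)) (β j + 1)).filter fun _ => i < j).image
      fun m => (i, j, m)).toList, ?_⟩
  intro i j m
  simp only [Finset.mem_toList, Finset.mem_biUnion, Finset.mem_univ, true_and, Finset.mem_image,
    Finset.mem_filter, Finset.mem_Icc, Prod.mk.injEq]
  constructor
  · rintro ⟨i, j, m, h, rfl, rfl, rfl⟩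
    exact ⟨h.2, h.1⟩
  · rintro ⟨h1, h2⟩
    exact ⟨i, j, m, ⟨h2, h1⟩, rfl, rfl, rfl⟩

theorem compl_sUnion_shi {n : ℕ} {β : Fin n → ℕ} {L : List (Fin n × Fin n × ℤ)}
    (hL : ∀ i j m, (i, j, m) ∈ L ↔ i < j ∧ -(β i : ℤ) ≤ m ∧ m ≤ β j + 1) :
    (⋃₀ extendedShiArrangement β)ᶜ = {x : sumZeroSpace n | Avoids L (x : Fin n → ℝ)} := by
  ext x
  constructor
  · rintro hx ⟨i, j, m⟩ ht he
    obtain ⟨h1, h2, h3⟩ := (hL i j m).1 ht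
    exact hx ⟨_, ⟨i, j, h1, m, h2, h3, rfl⟩, he⟩
  · rintro hx ⟨_, ⟨i, j, h1, m, h2, h3, rfl⟩, he⟩
    exact hx _ ((hL i j m).2 ⟨h1, h2, h3⟩) he

/-! ### Placements on a line and their encoding by gaps. -/

/-- Placements on a line: arc `i` occupies `p i, …, p i + b i - 1` inside `1, …, q - 1`, arcs are
disjoint, and an arc immediately followed by another has the smaller label. -/
def IsLinePlacement {n : ℕ} (b : Fin n → ℕ) (q : ℕ) (p : Fin n → ℕ) : Prop :=
  (∀ i, 1 ≤ p i ∧ p i + b i ≤ q) ∧ ∀ i j, i < j → p i + b i ≤ p j ∨ p j + b j < p i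

/-- Comparison of the pairs `(a k, k)` and `(a i, i)` in the lexicographic order. -/
def lexBefore {n : ℕ} (a : Fin n → ℕ) (k i : Fin n) : Prop :=
  a k < a i ∨ a k = a i ∧ k < i

open Classical in
/-- The placement in which arc `i` comes after `a i` empty cells. -/
noncomputable def placementOfGaps {n : ℕ} (b a : Fin n → ℕ) (i : Fin n) : ℕ :=
  1 + a i + ∑ k with lexBefore a k i, b k

/-- The number of empty cells among the positive cells to the left of arc `i`. -/
def gapsOfPlacement {n : ℕ} (b p : Fin n → ℕ) (i : Fin n) : ℕ :=
  p i - (1 + ∑ k with p k < p i, b k)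

section Line

variable {n : ℕ} {b : Fin n → ℕ} {q : ℕ}

theorem not_lexBefore_self (a : Fin n → ℕ) (i : Fin n) : ¬ lexBefore a i i := by
  unfold lexBefore; omega

theorem lexBefore_total (a : Fin n → ℕ) {i j : Fin n} (h : i ≠ j) :
    lexBefore a i j ∨ lexBefore a j i := by
  unfold lexBefore; omega

/-- Arc `i` and all arcs before it precede arc `j`. The additive form avoids truncated subtraction.
-/
theorem placementOfGaps_add_le {a : Fin n → ℕ} {i j : Fin n} (h : lexBefore a i j) :
    placementOfGaps b a i + b i + a j ≤ placementOfGaps b a j + a i := by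
  classical
  unfold placementOfGaps
  have hsub : insert i (Finset.univ.filter fun k => lexBefore a k i) ⊆
      Finset.univ.filter fun k => lexBefore a k j := by
    intro k hk
    simp only [Finset.mem_insert, Finset.mem_filter, Finset.mem_univ, true_and] at hk ⊢
    rcases hk with rfl | hk
    · exact h
    · unfold lexBefore at *; omega
  have hs := Finset.sum_le_sum_of_subset (f := b) hsub
  rw [Finset.sum_insert (by simpa using not_lexBefore_self a i)] at hs
  convert_to 1 + a i + (∑ k with lexBefore a k i, b k) + b i + a j ≤
    1 + a j + (∑ k with lexBefore a k j, b k) + a i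
  omega

theorem placementOfGaps_lt_iff (hb : ∀ i, 1 ≤ b i) (a : Fin n → ℕ) (i j : Fin n) :
    placementOfGaps b a i < placementOfGaps b a j ↔ lexBefore a i j := by
  have key : ∀ i j, lexBefore a i j → placementOfGaps b a i < placementOfGaps b a j := by
    intro i j h
    have h1 := placementOfGaps_add_le (b := b) h
    have h2 := hb i
    unfold lexBefore at h
    omega
  refine ⟨fun h => ?_, key i j⟩
  have hne : i ≠ j := by rintro rfl; exact h.false
  exact (lexBefore_total a hne).resolve_right fun h' => h.not_gt (key j i h')

theorem isLinePlacement_placementOfGaps {a : Fin n → ℕ} (hq : ∑ i, b i ≤ q)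
    (ha : ∀ i, a i < q - ∑ i, b i) : IsLinePlacement b q (placementOfGaps b a) := by
  classical
  constructor
  · intro i
    have hs := Finset.sum_le_sum_of_subset (f := b)
      (Finset.subset_univ (insert i (Finset.univ.filter fun k => lexBefore a k i)))
    rw [Finset.sum_insert (by simpa using not_lexBefore_self a i)] at hs
    have := ha i
    unfold placementOfGaps
    constructor
    · omega
    · convert_to 1 + a i + (∑ k with lexBefore a k i, b k) + b i ≤ q
      omega
  · intro i j hij
    rcases lexBefore_total a hij.ne with h | h
    · have h1 := placementOfGaps_add_le (b := b) h
      unfold lexBefore at h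
      omega
    · have h1 := placementOfGaps_add_le (b := b) h
      unfold lexBefore at h
      omega

theorem gapsOfPlacement_placementOfGaps (hb : ∀ i, 1 ≤ b i) (a : Fin n → ℕ) :
    gapsOfPlacement b (placementOfGaps b a) = a := by
  classical
  funext i
  unfold gapsOfPlacement
  simp only [placementOfGaps_lt_iff hb]
  rw [placementOfGaps]
  convert_to 1 + a i + (∑ k with lexBefore a k i, b k) - (1 + ∑ k with lexBefore a k i, b k) = a i
  omega

namespace IsLinePlacement

variable {p : Fin n → ℕ}

theorem add_le (hp : IsLinePlacement b q p) {i j : Fin n} (h : p i < p j) :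
    p i + b i ≤ p j := by
  rcases lt_trichotomy i j with hij | rfl | hij
  · have := hp.2 i j hij; omega
  · omega
  · have := hp.2 j i hij; omega

theorem add_lt (hp : IsLinePlacement b q p) {i j : Fin n} (h : p i < p j) (hij : j < i) :
    p i + b i < p j := by
  have := hp.2 j i hij; omega

theorem injective (hp : IsLinePlacement b q p) (hb : ∀ i, 1 ≤ b i) : Function.Injective p := by
  intro i j h
  have h1 := hb i
  have h2 := hb j
  rcases lt_trichotomy i j with hij | rfl | hij
  · have := hp.2 i j hij; omega
  · rfl
  · have := hp.2 j i hij; omega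

/-- The arcs are disjoint intervals inside `[lo, hi)`, so their lengths add up to at most `hi - lo`.
-/
theorem add_sum_le (hp : IsLinePlacement b q p) (hb : ∀ i, 1 ≤ b i) {s : Finset (Fin n)}
    {lo hi : ℕ} (hle : lo ≤ hi) (hs : ∀ k ∈ s, lo ≤ p k ∧ p k + b k ≤ hi) :
    lo + ∑ k ∈ s, b k ≤ hi := by
  have hd : (s : Set (Fin n)).PairwiseDisjoint fun k => Finset.Ico (p k) (p k + b k) := by
    intro k _ l _ hkl
    refine Finset.disjoint_left.2 fun x hx hx' => ?_
    simp only [Finset.mem_Ico] at hx hx'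
    rcases lt_or_gt_of_ne fun h => hkl (hp.injective hb h) with h | h
    · have := hp.add_le h; omega
    · have := hp.add_le h; omega
  have hc := Finset.card_biUnion hd
  have hsub : s.biUnion (fun k => Finset.Ico (p k) (p k + b k)) ⊆ Finset.Ico lo hi := by
    intro x hx
    obtain ⟨k, hk, hx⟩ := Finset.mem_biUnion.1 hx
    have := hs k hk
    simp only [Finset.mem_Ico] at hx ⊢
    omega
  have hcard := Finset.card_le_card hsub
  rw [hc] at hcard
  simp at hcard
  omega

theorem lt_size (hp : IsLinePlacement b q p) (hb : ∀ i, 1 ≤ b i) (i : Fin n) : p i < q := by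
  have := hp.1 i
  have := hb i
  omega

theorem add_sum_lt_le (hp : IsLinePlacement b q p) (hb : ∀ i, 1 ≤ b i) (i : Fin n) :
    1 + ∑ k with p k < p i, b k ≤ p i := by
  refine hp.add_sum_le hb (hp.1 i).1 fun k hk => ⟨(hp.1 k).1, hp.add_le ?_⟩
  simpa using hk

theorem gaps_lt (hp : IsLinePlacement b q p) (hb : ∀ i, 1 ≤ b i) (i : Fin n) :
    gapsOfPlacement b p i < q - ∑ i, b i := by
  have h1 := hp.add_sum_lt_le hb i
  have h2 : p i + ∑ k with ¬ p k < p i, b k ≤ q := by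
    refine hp.add_sum_le hb (by have := hp.1 i; omega) fun k hk => ⟨?_, (hp.1 k).2⟩
    simpa using hk
  have h3 := Finset.sum_filter_add_sum_filter_not Finset.univ (fun k => p k < p i) b
  have h4 := (hp.1 i).1
  unfold gapsOfPlacement
  omega

/-- In additive form: gap counts weakly increase from left to right, and strictly when the label
drops, since an arc may not touch a successor of smaller label. This makes the lexicographic order
recover the order of positions. -/
theorem add_sum_add_le (hp : IsLinePlacement b q p) (hb : ∀ i, 1 ≤ b i) (d : ℕ) :
    ∀ i j, p i < p j → p j - p i = d →
      (p i + ∑ k with p k < p j, b k ≤ p j + ∑ k with p k < p i, b k) ∧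
      (j < i → p i + ∑ k with p k < p j, b k < p j + ∑ k with p k < p i, b k) := by
  induction d using Nat.strong_induction_on with
  | _ d ih =>
  intro i j hij hd
  by_cases hk : ∃ k, p i < p k ∧ p k < p j
  · obtain ⟨k, h1, h2⟩ := hk
    have e1 := ih (p k - p i) (by omega) i k h1 rfl
    have e2 := ih (p j - p k) (by omega) k j h2 rfl
    refine ⟨by omega, fun hji => ?_⟩
    -- If `j < i`, the label drops on at least one of the two legs `i → k` and `k → j`.
    rcases lt_or_ge j k with h | h
    · have := e2.2 h; omega
    · have := e1.2 (lt_of_le_of_lt h hji); omega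
  · push Not at hk
    have hset : (Finset.univ.filter fun k => p k < p j) =
        insert i (Finset.univ.filter fun k => p k < p i) := by
      ext k
      simp only [Finset.mem_insert, Finset.mem_filter, Finset.mem_univ, true_and]
      have := hk k
      constructor
      · intro h
        rcases lt_trichotomy (p k) (p i) with h' | h' | h'
        · exact Or.inr h'
        · exact Or.inl (hp.injective hb h')
        · omega
      · rintro (rfl | h)
        · exact hij
        · omega
    rw [hset, Finset.sum_insert (by simp)]
    have h1 := hp.add_le hij
    refine ⟨by omega, fun hji => ?_⟩
    have := hp.add_lt hij hji
    omega

theorem lexBefore_gaps_iff (hp : IsLinePlacement b q p) (hb : ∀ i, 1 ≤ b i) (i j : Fin n) :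
    lexBefore (gapsOfPlacement b p) i j ↔ p i < p j := by
  have key : ∀ i j, p i < p j → lexBefore (gapsOfPlacement b p) i j := by
    intro i j h
    have h1 := hp.add_sum_add_le hb _ i j h rfl
    have h2 := hp.add_sum_lt_le hb i
    have h3 := hp.add_sum_lt_le hb j
    have hne : i ≠ j := by rintro rfl; exact h.false
    unfold lexBefore gapsOfPlacement
    rcases lt_or_gt_of_ne hne with h' | h'
    · omega
    · have := h1.2 h'; omega
  refine ⟨fun h => ?_, key i j⟩
  by_contra hle
  have hne : p j ≠ p i := by
    intro e
    have := hp.injective hb e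
    subst this
    unfold lexBefore at h
    omega
  have h' := key j i (by omega)
  unfold lexBefore at h h'
  omega

theorem placementOfGaps_gaps (hp : IsLinePlacement b q p) (hb : ∀ i, 1 ≤ b i) :
    placementOfGaps b (gapsOfPlacement b p) = p := by
  funext i
  have h1 := hp.add_sum_lt_le hb i
  rw [placementOfGaps]
  simp only [hp.lexBefore_gaps_iff hb]
  convert_to 1 + gapsOfPlacement b p i + (∑ k with p k < p i, b k) = p i
  unfold gapsOfPlacement
  omega

end IsLinePlacement

theorem ncard_isLinePlacement (hb : ∀ i, 1 ≤ b i) (hq : ∑ i, b i ≤ q) :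
    {p | IsLinePlacement b q p}.ncard = (q - ∑ i, b i) ^ n := by
  have hbij : Set.BijOn (placementOfGaps b)
      (Fintype.piFinset fun _ : Fin n => Finset.range (q - ∑ i, b i) : Finset (Fin n → ℕ))
      {p | IsLinePlacement b q p} := by
    refine Set.InvOn.bijOn (f' := gapsOfPlacement b)
      ⟨fun a _ => gapsOfPlacement_placementOfGaps hb a, fun p hp => ?_⟩ ?_ ?_
    · exact IsLinePlacement.placementOfGaps_gaps hp hb
    · intro a ha
      refine isLinePlacement_placementOfGaps hq fun i => ?_
      simpa using Fintype.mem_piFinset.1 ha i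
    · intro p hp
      refine Finset.mem_coe.2 (Fintype.mem_piFinset.2 fun i => ?_)
      simpa using IsLinePlacement.gaps_lt hp hb i
  rw [← hbij.image_eq, hbij.injOn.ncard_image, Set.ncard_coe_finset]
  simp

end Line

/-! ### Placements on a circle. -/

/-- The cell `e` of the circle `ℤ/q` lies in none of the arcs `x i, …, x i + b i - 1`. -/
def IsEmptyCell {n : ℕ} (b : Fin n → ℕ) {q : ℕ} (x : Fin n → ZMod q) (e : ZMod q) : Prop :=
  ∀ i, ∀ t < b i, x i + (t : ZMod q) ≠ e

/-- The points modulo `q` off the hyperplanes of the extended Shi arrangement, as placements of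
arcs of lengths `b i` on a circle. -/
def IsCirclePlacement {n : ℕ} (b : Fin n → ℕ) {q : ℕ} (x : Fin n → ZMod q) : Prop :=
  ∀ i j, i < j → ∀ m : ℤ, 1 - (b i : ℤ) ≤ m → m ≤ b j → x i - x j ≠ (m : ZMod q)

section Circle

variable {n : ℕ} {b : Fin n → ℕ} {q : ℕ}

theorem natCast_sub_eq_intCast_iff {u v : ℕ} {m : ℤ} :
    (u : ZMod q) - (v : ZMod q) = (m : ZMod q) ↔ (q : ℤ) ∣ m - (u - v) := by
  rw [← ZMod.intCast_eq_intCast_iff_dvd_sub]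
  push_cast
  rfl

theorem isCirclePlacement_natCast {p : Fin n → ℕ} (hp : IsLinePlacement b q p) :
    IsCirclePlacement b (fun i => (p i : ZMod q)) := by
  intro i j hij m h1 h2 h
  obtain ⟨c, hc⟩ := natCast_sub_eq_intCast_iff.1 h
  have hi := hp.1 i
  have hj := hp.1 j
  have := hp.2 i j hij
  have hc1 : c < 2 := by by_contra! hcc; nlinarith
  have hc2 : -2 < c := by by_contra! hcc; nlinarith
  -- The case `c = 0` is excluded by the line condition. The cases `c = ±1`, which go around the
  -- circle, are excluded because cell `0` separates the last arc from the first.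
  have : c = -1 ∨ c = 0 ∨ c = 1 := by omega
  rcases this with rfl | rfl | rfl <;> omega

theorem isEmptyCell_natCast {p : Fin n → ℕ} (hp : IsLinePlacement b q p) :
    IsEmptyCell b (fun i => (p i : ZMod q)) 0 := by
  intro i t ht h
  have hi := hp.1 i
  have h' : ((p i + t : ℕ) : ZMod q) = 0 := by push_cast; exact h
  have := Nat.le_of_dvd (by omega) ((ZMod.natCast_eq_zero_iff _ _).1 h')
  omega

theorem isLinePlacement_val [NeZero q] (hb : ∀ i, 1 ≤ b i) {x : Fin n → ZMod q}
    (hx : IsCirclePlacement b x) (h0 : IsEmptyCell b x 0) :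
    IsLinePlacement b q fun i => (x i).val := by
  have hval : ∀ i, (((x i).val : ℕ) : ZMod q) = x i := fun i => ZMod.natCast_zmod_val _
  constructor
  · intro i
    constructor
    · by_contra! h
      refine h0 i 0 (hb i) ?_
      rw [← hval i, show (x i).val = 0 by omega]
      simp
    · by_contra! h
      have hlt := ZMod.val_lt (x i)
      -- An arc running past the end would cover the cell `q`, which is `0` in `ZMod q`.
      refine h0 i (q - (x i).val) (by omega) ?_
      rw [Nat.cast_sub hlt.le, hval]
      simp
  · intro i j hij
    by_contra! h
    refine hx i j hij ((x i).val - (x j).val) (by omega) (by omega) ?_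
    push_cast
    rw [hval, hval]

theorem ncard_circlePlacement_emptyCell_zero [NeZero q] (hb : ∀ i, 1 ≤ b i)
    (hq : ∑ i, b i ≤ q) :
    {x : Fin n → ZMod q | IsCirclePlacement b x ∧ IsEmptyCell b x 0}.ncard =
      (q - ∑ i, b i) ^ n := by
  rw [← ncard_isLinePlacement hb hq]
  have hbij : Set.BijOn (fun (x : Fin n → ZMod q) i => (x i).val)
      {x | IsCirclePlacement b x ∧ IsEmptyCell b x 0} {p | IsLinePlacement b q p} := by
    refine Set.InvOn.bijOn (f' := fun p i => (p i : ZMod q)) ⟨?_, ?_⟩ ?_ ?_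
    · intro x _
      funext i
      exact ZMod.natCast_zmod_val _
    · intro p hp
      funext i
      exact ZMod.val_natCast_of_lt (IsLinePlacement.lt_size hp hb i)
    · exact fun x hx => isLinePlacement_val hb hx.1 hx.2
    · exact fun p hp => ⟨isCirclePlacement_natCast hp, isEmptyCell_natCast hp⟩
  rw [← hbij.image_eq, hbij.injOn.ncard_image]

/-- Rotation by `e` preserves all differences of positions. -/
theorem ncard_circlePlacement_emptyCell (e : ZMod q) :
    {x : Fin n → ZMod q | IsCirclePlacement b x ∧ IsEmptyCell b x e}.ncard =
      {x : Fin n → ZMod q | IsCirclePlacement b x ∧ IsEmptyCell b x 0}.ncard := by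
  have hinj : Function.Injective fun (x : Fin n → ZMod q) i => x i + e := fun x y h => by
    funext i
    simpa using congrFun h i
  rw [← Set.ncard_image_of_injective
    {x : Fin n → ZMod q | IsCirclePlacement b x ∧ IsEmptyCell b x 0} hinj]
  congr 1
  ext x
  constructor
  · rintro ⟨h1, h2⟩
    refine ⟨fun i => x i - e, ⟨?_, ?_⟩, by simp⟩
    · intro i j hij m hm hm'
      simpa using h1 i j hij m hm hm'
    · intro i t ht h
      refine h2 i t ht ?_
      rw [← sub_eq_zero, ← h]; ring
  · rintro ⟨y, ⟨h1, h2⟩, rfl⟩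
    refine ⟨?_, ?_⟩
    · intro i j hij m hm hm'
      simpa using h1 i j hij m hm hm'
    · intro i t ht h
      refine h2 i t ht ?_
      have := sub_eq_zero.2 h
      rw [← this]; ring

/-- The covered cells are pairwise distinct: different arcs are disjoint, and `b i ≤ q` keeps an arc
from overlapping itself. -/
theorem card_emptyCell [NeZero q] {x : Fin n → ZMod q} (hbq : ∀ i, b i ≤ q)
    (hx : IsCirclePlacement b x) : {e | IsEmptyCell b x e}.ncard = q - ∑ i, b i := by
  let f : (Σ i, Fin (b i)) → ZMod q := fun s => x s.1 + ((s.2 : ℕ) : ZMod q)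
  have hlt : ∀ i j (s : Fin (b i)) (t : Fin (b j)), i < j → f ⟨i, s⟩ ≠ f ⟨j, t⟩ := by
    intro i j s t hij h
    refine hx i j hij ((t : ℕ) - (s : ℕ)) (by omega) (by omega) ?_
    push_cast
    rw [sub_eq_sub_iff_add_eq_add]
    simpa [add_comm] using h
  have hinj : Function.Injective f := by
    rintro ⟨i, s⟩ ⟨j, t⟩ h
    rcases lt_trichotomy i j with hij | rfl | hij
    · exact absurd h (hlt _ _ _ _ hij)
    · have h' : ((s : ℕ) : ZMod q) = ((t : ℕ) : ZMod q) := by simpa [f] using h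
      have hs := ZMod.val_natCast_of_lt (s.2.trans_le (hbq i))
      have ht := ZMod.val_natCast_of_lt (t.2.trans_le (hbq i))
      have : (s : ℕ) = t := by rw [← hs, ← ht, h']
      rw [Fin.ext this]
    · exact absurd h.symm (hlt _ _ _ _ hij)
  have hset : {e | IsEmptyCell b x e} = (Set.range f)ᶜ := by
    ext e
    simp only [IsEmptyCell, Set.mem_ofPred_eq, Set.mem_compl_iff, Set.mem_range, Sigma.exists,
      not_exists, f]
    exact forall_congr' fun i => ⟨fun h t => h t t.2, fun h t ht => h ⟨t, ht⟩⟩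
  rw [hset, Set.ncard_compl, ← Set.image_univ, Set.ncard_image_of_injective _ hinj,
    Set.ncard_univ]
  simp [Nat.card_eq_fintype_card]

/-- The number of points modulo `q` off the hyperplanes of the extended Shi arrangement. -/
theorem ncard_isCirclePlacement [NeZero q] (hn : 1 ≤ n) (hb : ∀ i, 1 ≤ b i)
    (hq : ∑ i, b i < q) :
    {x : Fin n → ZMod q | IsCirclePlacement b x}.ncard = q * (q - ∑ i, b i) ^ (n - 1) := by
  classical
  have hbq : ∀ i, b i ≤ q := fun i =>
    (Finset.single_le_sum (f := b) (fun _ _ => Nat.zero_le _) (Finset.mem_univ i)).trans hq.le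
  have hdc := Finset.sum_card_bipartiteAbove_eq_sum_card_bipartiteBelow
    (s := Finset.univ.filter fun x : Fin n → ZMod q => IsCirclePlacement b x)
    (t := Finset.univ) (IsEmptyCell b)
  have h1 : ∀ x ∈ Finset.univ.filter fun x : Fin n → ZMod q => IsCirclePlacement b x,
      (Finset.univ.bipartiteAbove (IsEmptyCell b) x).card = q - ∑ i, b i := by
    intro x hx
    rw [← card_emptyCell hbq (Finset.mem_filter.1 hx).2, ← Set.ncard_coe_finset]
    simp [Finset.bipartiteAbove]
  have h2 : ∀ e ∈ (Finset.univ : Finset (ZMod q)),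
      ((Finset.univ.filter fun x : Fin n → ZMod q => IsCirclePlacement b x).bipartiteBelow
        (IsEmptyCell b) e).card = (q - ∑ i, b i) ^ n := by
    intro e _
    rw [← ncard_circlePlacement_emptyCell_zero hb hq.le, ← ncard_circlePlacement_emptyCell e,
      ← Set.ncard_coe_finset]
    simp [Finset.bipartiteBelow, Set.ofPred_and]
  rw [Finset.sum_congr rfl h1, Finset.sum_congr rfl h2] at hdc
  simp only [Finset.sum_const, smul_eq_mul, Finset.card_univ, ZMod.card] at hdc
  have hc : {x : Fin n → ZMod q | IsCirclePlacement b x}.ncard =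
      (Finset.univ.filter fun x : Fin n → ZMod q => IsCirclePlacement b x).card := by
    rw [← Set.ncard_coe_finset]
    simp
  obtain ⟨k, rfl⟩ : ∃ k, n = k + 1 := ⟨n - 1, by omega⟩
  rw [hc]
  -- The double count carries an extra factor `q - ∑ b i`, cancelled here because `∑ b i < q` is
  -- strict.
  refine Nat.eq_of_mul_eq_mul_right (Nat.sub_pos_of_lt hq) ?_
  rw [hdc, Nat.add_sub_cancel, pow_succ, mul_assoc]

end Circle

/-! ### Identification of the polynomial and its value at `-1`. -/

/-- The number of regions of the `β`-extended Shi arrangement is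
`(∑_j (β(j) + 1) + 1)^(n - 1)`. -/
theorem mainTheorem6 (n : ℕ) (hn : 1 ≤ n) (β : Fin n → ℕ) :
    (arrangementRegions (extendedShiArrangement β)).Finite ∧
      (arrangementRegions (extendedShiArrangement β)).ncard =
        ((∑ j : Fin n, (β j + 1)) + 1) ^ (n - 1) := by
  obtain ⟨L, hL⟩ := exists_list_shi β
  obtain ⟨hfin, hcard⟩ := arrangementRegions_count (compl_sUnion_shi hL)
  refine ⟨hfin, ?_⟩
  obtain ⟨P, hP, hr⟩ := exists_charPoly L.length (Fin n) L rfl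
  have hev : ∀ᶠ q : ℕ in atTop, P.eval (q : ℤ) =
      (X * (X - C ((∑ j : Fin n, (β j + 1) : ℕ) : ℤ)) ^ (n - 1) : ℤ[X]).eval (q : ℤ) := by
    filter_upwards [hP, eventually_gt_atTop (∑ j : Fin n, (β j + 1))] with q h1 h2
    have : NeZero q := ⟨by omega⟩
    have hcount : modCount L q = q * (q - ∑ j : Fin n, (β j + 1)) ^ (n - 1) := by
      rw [← ncard_isCirclePlacement hn (fun i => Nat.le_add_left 1 (β i)) h2, modCount]
      congr 1
      ext x
      constructor
      · intro h i j hij m hm hm'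
        exact h (i, j, m) ((hL i j m).2 ⟨hij, by push_cast at hm; omega, by exact_mod_cast hm'⟩)
      · rintro h ⟨i, j, m⟩ ht
        obtain ⟨hij, hm, hm'⟩ := (hL i j m).1 ht
        exact h i j hij m (by push_cast; omega) (by exact_mod_cast hm')
    rw [← h1, hcount, eval_mul, eval_pow, eval_sub, eval_X, eval_C, Nat.cast_mul, Nat.cast_pow,
      Nat.cast_sub h2.le]
  have hPeq : P = X * (X - C ((∑ j : Fin n, (β j + 1) : ℕ) : ℤ)) ^ (n - 1) := by
    refine Polynomial.eq_of_infinite_eval_eq _ _ ?_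
    obtain ⟨Q, hQ⟩ := eventually_atTop.1 hev
    refine ((Set.Ici_infinite Q).image (Nat.cast_injective (R := ℤ)).injOn).mono ?_
    rintro _ ⟨q, hq, rfl⟩
    exact hQ q hq
  obtain ⟨k, rfl⟩ : ∃ k, n = k + 1 := ⟨n - 1, by omega⟩
  have hfinal : ((realizedPatterns L).ncard : ℤ) =
      (((∑ j : Fin (k + 1), (β j + 1)) + 1) ^ (k + 1 - 1) : ℕ) := by
    -- With `n = k + 1`, the factor `X` at `-1` uses up one sign and the other `k` signs turn `(-1 -
    -- s) ^ k` into `(s + 1) ^ k`.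
    rw [hr, hPeq, Fintype.card_fin, eval_mul, eval_pow, eval_sub, eval_X, eval_C, pow_succ,
      Nat.add_sub_cancel, mul_assoc, ← mul_assoc (-1 : ℤ) (-1), neg_one_mul, neg_neg, one_mul,
      ← mul_pow]
    push_cast
    ring
  rw [hcard]
  exact_mod_cast hfinal
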